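/- Let $\mathcal V$ be a closed, cocomplete, symmetric monoidal category with tensor product $\otimes$ and unit $\mathbb S$, and suppose that $\mathcal V$ is semi-additive (finite products and coproducts coincide naturally, so that its hom-sets are commutative monoids). An object $X$ of $\mathcal V$ is dualizable if there are an object $X^*$ and morphisms $\eta\colon\mathbb S\to X\otimes X^*$, $\epsilon\colon X^*\otimes X\to\mathbb S$ satisfying the two triangle identities; the trace $\operatorname{tr}(g)\colon\mathbb S\to\mathbb S$ of $g\colon X\to X$ is then the composite $$\mathbb S\xrightarrow{\eta}X\otimes X^*\xrightarrow{g\otimes\mathrm{id}}X\otimes X^*\cong X^*\otimes X\xrightarrow{\epsilon}\mathbb S .$$ Let $A$ be a finite category. For functors $\Phi\colon A^{\mathrm{op}}\to\mathcal V$ and $X\colon A\to\mathcal V$ put $\operatorname{colim}^\Phi(X)=\int^{a\in A}\Phi(a)\otimes X(a)$. The weight $\Phi$ is absolute if it is right dualizable as a $\mathcal V$-profunctor from the terminal category to $A$, that is, if there are a functor $Y\colon A\to\mathcal V$, a morphism $\eta\colon\mathbb S\to\int^{a}\Phi(a)\otimes Y(a)$, and morphisms $\epsilon_{a,b}\colon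 Y(b)\otimes\Phi(a)\to A(a,b)\cdot\mathbb S$ natural in $a$ and $b$ (where $A(a,b)\cdot\mathbb S$ denotes a coproduct of copies of $\mathbb S$), such that for every $a\in A$ the composites $$\Phi(a)\xrightarrow{\eta\otimes\mathrm{id}}\int^{b}\Phi(b)\otimes Y(b)\otimes\Phi(a)\xrightarrow{\mathrm{id}\otimes\epsilon}\int^{b}\Phi(b)\otimes\bigl(A(a,b)\cdot\mathbb S\bigr)\cong\Phi(a),$$ $$Y(a)\xrightarrow{\mathrm{id}\otimes\eta}\int^{b}Y(a)\otimes\Phi(b)\otimes Y(b)\xrightarrow{\epsilon\otimes\mathrm{id}}\int^{b}\bigl(A(b,a)\cdot\mathbb S\bigr)\otimes Y(b)\cong Y(a)$$ are identities. The trace of $\mathrm{id}_\Phi$ is the composite $$\mathbb S\xrightarrow{\eta}\int^{a}\Phi(a)\otimes Y(a)\cong\int^{a}Y(a)\otimes\Phi(a)\xrightarrow{\epsilon}\int^{a}A(a,a)\cdot\mathbb S\cong\bigoplus_{[\alpha]}\mathbb S ,$$ where $[\alpha]$ ranges over the conjugacy classes of endomorphisms in $A$, i.e. the classes of the equivalence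 relation on the disjoint union of the sets $A(a,a)$ generated by $\alpha\circ\beta\sim\beta\circ\alpha$ for all $\alpha\colon a\to b$ and $\beta\colon b\to a$. Let $\phi_{[\alpha]}\colon\mathbb S\to\mathbb S$ be the component of $\operatorname{tr}(\mathrm{id}_\Phi)$ at $[\alpha]$. Theorem. Let $\Phi\colon A^{\mathrm{op}}\to\mathcal V$ be absolute and let $X\colon A\to\mathcal V$ be a functor such that each $X(a)$ is dualizable. Then $\operatorname{colim}^\Phi(X)$ is dualizable, $$\operatorname{tr}\bigl(\mathrm{id}_{\operatorname{colim}^\Phi(X)}\bigr)=\sum_{[\alpha]}\phi_{[\alpha]}\cdot\operatorname{tr}(X_\alpha),$$ and, more generally, for every natural transformation $f\colon X\to X$, $$\operatorname{tr}\bigl(\operatorname{colim}^\Phi(f)\bigr)=\sum_{[\alpha]}\phi_{[\alpha]}\cdot\operatorname{tr}(f_a\circ X_\alpha).$$ Here $\alpha\colon a\to a$ is an arbitrary representative of its conjugacy class, and the product and the sum are the composition and the addition of $\mathcal V(\mathbb S,\mathbb S)$. -/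

import Mathlib

open CategoryTheory MonoidalCategory Limits Opposite

universe w v u

set_option linter.unusedSectionVars false

namespace WeightedColim

noncomputable section

section Monoidal

variable {V : Type u} [Category.{v} V] [MonoidalCategory V]

/-- The trace `𝟙 ⟶ X ⊗ X* ⟶ X ⊗ X* ≅ X* ⊗ X ⟶ 𝟙` of an endomorphism `f` of a dualizable object `X`.
`HasRightDual X` is a choice of `X*` together with a coevaluation `𝟙 ⟶ X ⊗ X*` and an evaluation
`X* ⊗ X ⟶ 𝟙` satisfying the two triangle identities. -/
def trace [SymmetricCategory V] {X : V} [HasRightDual X] (f : X ⟶ X) : 𝟙_ V ⟶ 𝟙_ V :=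
  η_ X Xᘁ ≫ f ▷ Xᘁ ≫ (β_ X Xᘁ).hom ≫ ε_ X Xᘁ

variable {A : Type w} [SmallCategory A]

/-- The bifunctor `(a, a') ↦ Φ a ⊗ X a'`. -/
@[simps]
def tensorDiagram (Φ : Aᵒᵖ ⥤ V) (X : A ⥤ V) : Aᵒᵖ ⥤ A ⥤ V where
  obj a :=
    { obj := fun a' => Φ.obj a ⊗ X.obj a'
      map := fun f => Φ.obj a ◁ X.map f }
  map f := { app := fun a' => Φ.map f ▷ X.obj a'
             naturality := fun _ _ g => (whisker_exchange (Φ.map f) (X.map g)) }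

/-- The bifunctor `(a, a') ↦ Y a' ⊗ Φ a`, that is, the composite profunctor `Y ⊙ Φ : A ⇸ A` of
`Y : A ⇸ 1` and `Φ : 1 ⇸ A`. -/
@[simps]
def outerDiagram (Y : A ⥤ V) (Φ : Aᵒᵖ ⥤ V) : Aᵒᵖ ⥤ A ⥤ V where
  obj a :=
    { obj := fun a' => Y.obj a' ⊗ Φ.obj a
      map := fun f => Y.map f ▷ Φ.obj a }
  map f := { app := fun a' => Y.obj a' ◁ Φ.map f
             naturality := fun _ _ g => (whisker_exchange (Y.map g) (Φ.map f)).symm }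

/-- The natural transformation `Φ a ⊗ X a' ⟶ Φ a ⊗ X' a'` induced by `f : X ⟶ X'`. -/
@[simps]
def tensorDiagramMap (Φ : Aᵒᵖ ⥤ V) {X X' : A ⥤ V} (f : X ⟶ X') :
    tensorDiagram Φ X ⟶ tensorDiagram Φ X' where
  app a := { app := fun a' => Φ.obj a ◁ f.app a'
             naturality := fun _ _ g => by
               change Φ.obj a ◁ X.map g ≫ Φ.obj a ◁ f.app _ = Φ.obj a ◁ f.app _ ≫ Φ.obj a ◁ X'.map g
               rw [← MonoidalCategory.whiskerLeft_comp, ← MonoidalCategory.whiskerLeft_comp,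
                 f.naturality] }
  naturality _ _ g := by
    ext a'
    exact (whisker_exchange (Φ.map g) (f.app a')).symm

/-- The symmetry `Φ a ⊗ Y a' ⟶ Y a' ⊗ Φ a`, natural in both variables. -/
@[simps]
def tensorDiagramSwap [SymmetricCategory V] (Φ : Aᵒᵖ ⥤ V) (Y : A ⥤ V) :
    tensorDiagram Φ Y ⟶ outerDiagram Y Φ where
  app a := { app := fun a' => (β_ (Φ.obj a) (Y.obj a')).hom
             naturality := fun _ _ g => BraidedCategory.braiding_naturality_right _ _ }
  naturality _ _ g := by
    ext a'
    exact BraidedCategory.braiding_naturality_left (Φ.map g) (Y.obj a')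

variable [HasColimitsOfSize.{w, w} V]

/-- The `Φ`-weighted colimit `∫^a Φ a ⊗ X a` of `X`. -/
abbrev wcolim (Φ : Aᵒᵖ ⥤ V) (X : A ⥤ V) : V := coend (tensorDiagram Φ X)

/-- The coprojection `Φ a ⊗ X a ⟶ ∫^a Φ a ⊗ X a`. -/
def wcolimι (Φ : Aᵒᵖ ⥤ V) (X : A ⥤ V) (a : A) : Φ.obj (op a) ⊗ X.obj a ⟶ wcolim Φ X :=
  coend.ι (tensorDiagram Φ X) a

/-- The morphism out of `∫^a Φ a ⊗ X a` with given components. -/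
def wcolimDesc (Φ : Aᵒᵖ ⥤ V) (X : A ⥤ V) {W : V} (g : ∀ a : A, Φ.obj (op a) ⊗ X.obj a ⟶ W)
    (hg : ∀ ⦃a b : A⦄ (f : a ⟶ b),
      Φ.map f.op ▷ X.obj a ≫ g a = Φ.obj (op b) ◁ X.map f ≫ g b) : wcolim Φ X ⟶ W :=
  coend.desc (F := tensorDiagram Φ X) g hg

lemma wcolimι_desc (Φ : Aᵒᵖ ⥤ V) (X : A ⥤ V) {W : V} (g : ∀ a : A, Φ.obj (op a) ⊗ X.obj a ⟶ W)
    (hg : ∀ ⦃a b : A⦄ (f : a ⟶ b),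
      Φ.map f.op ▷ X.obj a ≫ g a = Φ.obj (op b) ◁ X.map f ≫ g b) (a : A) :
    wcolimι Φ X a ≫ wcolimDesc Φ X g hg = g a :=
  coend.ι_desc (F := tensorDiagram Φ X) g hg a

/-- The morphism of weighted colimits induced by a natural transformation. -/
def wcolimMap (Φ : Aᵒᵖ ⥤ V) {X X' : A ⥤ V} (f : X ⟶ X') : wcolim Φ X ⟶ wcolim Φ X' :=
  coend.map (tensorDiagramMap Φ f)

variable (V A) in
/-- The unit profunctor `A ⇸ A`: the bifunctor sending `(a, a')` to the copower `A(a, a') · 𝟙`. -/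
def unitProf : Aᵒᵖ ⥤ A ⥤ V :=
  coyoneda ⋙ (Functor.whiskeringRight A (Type w) V).obj (sigmaConst.obj (𝟙_ V))

/-- The coprojection `𝟙 ⟶ A(a, a') · 𝟙` at `α : a ⟶ a'`. -/
def unitProfι {a a' : A} (α : a ⟶ a') : 𝟙_ V ⟶ ((unitProf V A).obj (op a)).obj a' :=
  Sigma.ι (fun _ : (a ⟶ a') => 𝟙_ V) α

/-- The morphism out of `A(a, a') · 𝟙` with given components. -/
def unitProfDesc {a a' : A} {W : V} (g : (a ⟶ a') → (𝟙_ V ⟶ W)) :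
    ((unitProf V A).obj (op a)).obj a' ⟶ W :=
  Sigma.desc (f := fun _ : (a ⟶ a') => 𝟙_ V) g

lemma unitProfι_desc {a a' : A} {W : V} (g : (a ⟶ a') → (𝟙_ V ⟶ W)) (α : a ⟶ a') :
    unitProfι α ≫ unitProfDesc g = g α := by
  exact Sigma.ι_desc (f := fun _ : (a ⟶ a') => 𝟙_ V) g α

lemma unitProf_hom_ext {a a' : A} {W : V} {g h : ((unitProf V A).obj (op a)).obj a' ⟶ W}
    (H : ∀ α : a ⟶ a', unitProfι α ≫ g = unitProfι α ≫ h) : g = h :=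
  Sigma.hom_ext (f := fun _ : (a ⟶ a') => 𝟙_ V) _ _ H

lemma unitProfι_map {a a' a'' : A} (α : a ⟶ a') (f : a' ⟶ a'') :
    unitProfι (V := V) α ≫ ((unitProf V A).obj (op a)).map f = unitProfι (α ≫ f) := by
  simp [unitProfι, unitProf, sigmaConst]

lemma unitProfι_map_app {a a' b : A} (α : a ⟶ a') (f : b ⟶ a) :
    unitProfι (V := V) α ≫ ((unitProf V A).map f.op).app a' = unitProfι (f ≫ α) := by
  simp [unitProfι, unitProf, sigmaConst]

variable (V A) in
/-- The shadow `∫^a A(a, a) · 𝟙` of the unit profunctor of `A`. -/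
abbrev shadow : V := coend (unitProf V A)

end Monoidal

section Closed

variable {V : Type u} [Category.{v} V] [MonoidalCategory V] [SymmetricCategory V]
  [MonoidalClosed V] [HasColimitsOfSize.{w, w} V] {A : Type w} [SmallCategory A]

lemma tensorUnitProf_hom_ext {a a' : A} {Z W : V}
    {g h : Z ⊗ ((unitProf V A).obj (op a)).obj a' ⟶ W}
    (H : ∀ α : a ⟶ a', Z ◁ unitProfι α ≫ g = Z ◁ unitProfι α ≫ h) : g = h := by
  apply MonoidalClosed.curry_injective
  refine unitProf_hom_ext fun α => ?_
  rw [← MonoidalClosed.curry_natural_left, ← MonoidalClosed.curry_natural_left, H]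

lemma unitProfTensor_hom_ext {a a' : A} {Z W : V}
    {g h : ((unitProf V A).obj (op a)).obj a' ⊗ Z ⟶ W}
    (H : ∀ α : a ⟶ a', unitProfι α ▷ Z ≫ g = unitProfι α ▷ Z ≫ h) : g = h := by
  rw [← cancel_epi (β_ Z (((unitProf V A).obj (op a)).obj a')).hom]
  refine tensorUnitProf_hom_ext fun α => ?_
  rw [BraidedCategory.braiding_naturality_right_assoc,
    BraidedCategory.braiding_naturality_right_assoc, H]

/-- The action `Φ b ⊗ (A(a, b) · 𝟙) ⟶ Φ a` of the arrows of `A` on a presheaf: it is `Φ α` on the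
copy of `Φ b` at `α : a ⟶ b`. -/
def presheafAct (Φ : Aᵒᵖ ⥤ V) (a b : A) :
    Φ.obj (op b) ⊗ ((unitProf V A).obj (op a)).obj b ⟶ Φ.obj (op a) :=
  MonoidalClosed.uncurry
    (unitProfDesc fun α => MonoidalClosed.curry ((ρ_ (Φ.obj (op b))).hom ≫ Φ.map α.op))

lemma unitProfι_presheafAct (Φ : Aᵒᵖ ⥤ V) {a b : A} (α : a ⟶ b) :
    Φ.obj (op b) ◁ unitProfι α ≫ presheafAct Φ a b = (ρ_ (Φ.obj (op b))).hom ≫ Φ.map α.op := by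
  rw [presheafAct, ← MonoidalClosed.uncurry_natural_left, unitProfι_desc,
    MonoidalClosed.uncurry_curry]

/-- The action `(A(b, a) · 𝟙) ⊗ Y b ⟶ Y a` of the arrows of `A` on a functor: it is `Y α` on the
copy of `Y b` at `α : b ⟶ a`. -/
def functorAct (Y : A ⥤ V) (b a : A) :
    ((unitProf V A).obj (op b)).obj a ⊗ Y.obj b ⟶ Y.obj a :=
  (β_ _ _).hom ≫ MonoidalClosed.uncurry
    (unitProfDesc fun α => MonoidalClosed.curry ((ρ_ (Y.obj b)).hom ≫ Y.map α))

lemma unitProfι_functorAct (Y : A ⥤ V) {b a : A} (α : b ⟶ a) :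
    unitProfι α ▷ Y.obj b ≫ functorAct Y b a = (λ_ (Y.obj b)).hom ≫ Y.map α := by
  rw [functorAct, BraidedCategory.braiding_naturality_left_assoc,
    ← MonoidalClosed.uncurry_natural_left, unitProfι_desc, MonoidalClosed.uncurry_curry,
    braiding_rightUnitor_assoc]

lemma presheafAct_dinatural (Φ : Aᵒᵖ ⥤ V) (a : A) {b b' : A} (f : b ⟶ b') :
    Φ.map f.op ▷ _ ≫ presheafAct Φ a b =
      Φ.obj (op b') ◁ ((unitProf V A).obj (op a)).map f ≫ presheafAct Φ a b' := by
  refine tensorUnitProf_hom_ext fun α => ?_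
  rw [whisker_exchange_assoc, unitProfι_presheafAct, ← MonoidalCategory.whiskerLeft_comp_assoc,
    unitProfι_map, unitProfι_presheafAct, rightUnitor_naturality_assoc, op_comp, Φ.map_comp]

lemma functorAct_dinatural (Y : A ⥤ V) (a : A) {b b' : A} (f : b ⟶ b') :
    ((unitProf V A).map f.op).app a ▷ Y.obj b ≫ functorAct Y b a =
      _ ◁ Y.map f ≫ functorAct Y b' a := by
  refine unitProfTensor_hom_ext fun α => ?_
  rw [← whisker_exchange_assoc, unitProfι_functorAct, ← comp_whiskerRight_assoc,
    unitProfι_map_app, unitProfι_functorAct, leftUnitor_naturality_assoc, Y.map_comp]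

/-- The component `Y b ⊗ Φ a ⟶ A(a, b) · 𝟙` of a morphism of profunctors `ε : Y ⊙ Φ ⟶ 𝕀_A`. -/
def evApp {Φ : Aᵒᵖ ⥤ V} {Y : A ⥤ V} (ε : outerDiagram Y Φ ⟶ unitProf V A) (a b : A) :
    Y.obj b ⊗ Φ.obj (op a) ⟶ ((unitProf V A).obj (op a)).obj b :=
  (ε.app (op a)).app b

lemma evApp_naturality {Φ : Aᵒᵖ ⥤ V} {Y : A ⥤ V} (ε : outerDiagram Y Φ ⟶ unitProf V A)
    (a : A) {b b' : A} (f : b ⟶ b') :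
    Y.map f ▷ Φ.obj (op a) ≫ evApp ε a b' = evApp ε a b ≫ ((unitProf V A).obj (op a)).map f :=
  (ε.app (op a)).naturality f

lemma evApp_naturality_op {Φ : Aᵒᵖ ⥤ V} {Y : A ⥤ V} (ε : outerDiagram Y Φ ⟶ unitProf V A)
    (a : A) {b b' : A} (f : b ⟶ b') :
    Y.obj a ◁ Φ.map f.op ≫ evApp ε b a = evApp ε b' a ≫ ((unitProf V A).map f.op).app a :=
  congrArg (fun t => t.app a) (ε.naturality f.op)

/-- The composite `(Φ ⊙ Y) ⊙ Φ ≅ Φ ⊙ (Y ⊙ Φ) ⟶ Φ ⊙ 𝕀_A ≅ Φ` at `a`, whose middle arrow is induced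
by `ε : Y ⊙ Φ ⟶ 𝕀_A`. On the summand at `b` it is
`(Φ b ⊗ Y b) ⊗ Φ a ≅ Φ b ⊗ (Y b ⊗ Φ a) ⟶ Φ b ⊗ (A(a, b) · 𝟙) ⟶ Φ a`; it is defined through
the internal hom because `- ⊗ Φ a` preserves the coend. -/
def contractLeft {Φ : Aᵒᵖ ⥤ V} {Y : A ⥤ V} (ε : outerDiagram Y Φ ⟶ unitProf V A) (a : A) :
    wcolim Φ Y ⊗ Φ.obj (op a) ⟶ Φ.obj (op a) :=
  (β_ _ _).hom ≫ MonoidalClosed.uncurry (wcolimDesc Φ Y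
    (fun b => MonoidalClosed.curry ((β_ (Φ.obj (op a)) (Φ.obj (op b) ⊗ Y.obj b)).hom ≫
      (α_ _ _ _).hom ≫ Φ.obj (op b) ◁ evApp ε a b ≫ presheafAct Φ a b))
    (fun b b' f => by
      rw [← MonoidalClosed.curry_natural_left, ← MonoidalClosed.curry_natural_left,
        BraidedCategory.braiding_naturality_right_assoc,
        BraidedCategory.braiding_naturality_right_assoc,
        associator_naturality_left_assoc, associator_naturality_middle_assoc,
        ← whisker_exchange_assoc, presheafAct_dinatural,
        ← MonoidalCategory.whiskerLeft_comp_assoc, ← MonoidalCategory.whiskerLeft_comp_assoc,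
        evApp_naturality]))

lemma wcolimι_contractLeft {Φ : Aᵒᵖ ⥤ V} {Y : A ⥤ V} (ε : outerDiagram Y Φ ⟶ unitProf V A)
    (a b : A) :
    wcolimι Φ Y b ▷ Φ.obj (op a) ≫ contractLeft ε a =
      (α_ _ _ _).hom ≫ Φ.obj (op b) ◁ evApp ε a b ≫ presheafAct Φ a b := by
  rw [contractLeft, BraidedCategory.braiding_naturality_left_assoc,
    ← MonoidalClosed.uncurry_natural_left, wcolimι_desc, MonoidalClosed.uncurry_curry,
    SymmetricCategory.symmetry_assoc]

/-- The composite `Y ⊙ (Φ ⊙ Y) ≅ (Y ⊙ Φ) ⊙ Y ⟶ 𝕀_A ⊙ Y ≅ Y` at `a`, whose middle arrow is induced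
by `ε : Y ⊙ Φ ⟶ 𝕀_A`. On the summand at `b` it is
`Y a ⊗ (Φ b ⊗ Y b) ≅ (Y a ⊗ Φ b) ⊗ Y b ⟶ (A(b, a) · 𝟙) ⊗ Y b ⟶ Y a`. -/
def contractRight {Φ : Aᵒᵖ ⥤ V} {Y : A ⥤ V} (ε : outerDiagram Y Φ ⟶ unitProf V A) (a : A) :
    Y.obj a ⊗ wcolim Φ Y ⟶ Y.obj a :=
  MonoidalClosed.uncurry (wcolimDesc Φ Y
    (fun b => MonoidalClosed.curry ((α_ (Y.obj a) (Φ.obj (op b)) (Y.obj b)).inv ≫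
      evApp ε b a ▷ Y.obj b ≫ functorAct Y b a))
    (fun b b' f => by
      rw [← MonoidalClosed.curry_natural_left, ← MonoidalClosed.curry_natural_left,
        associator_inv_naturality_middle_assoc, associator_inv_naturality_right_assoc,
        whisker_exchange_assoc, ← functorAct_dinatural,
        ← comp_whiskerRight_assoc, ← comp_whiskerRight_assoc, evApp_naturality_op]))

lemma wcolimι_contractRight {Φ : Aᵒᵖ ⥤ V} {Y : A ⥤ V} (ε : outerDiagram Y Φ ⟶ unitProf V A)
    (a b : A) :
    Y.obj a ◁ wcolimι Φ Y b ≫ contractRight ε a =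
      (α_ _ _ _).inv ≫ evApp ε b a ▷ Y.obj b ≫ functorAct Y b a := by
  rw [contractRight, ← MonoidalClosed.uncurry_natural_left, wcolimι_desc,
    MonoidalClosed.uncurry_curry]

/-- A right dual of a weight `Φ : Aᵒᵖ ⥤ V`, regarded as a profunctor `1 ⇸ A`: a profunctor
`Y : A ⇸ 1` with a coevaluation `η : 𝟙 ⟶ Φ ⊙ Y` and an evaluation `ε : Y ⊙ Φ ⟶ 𝕀_A` satisfying
both triangle identities. -/
structure RightDual (Φ : Aᵒᵖ ⥤ V) where
  dual : A ⥤ V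
  coev : 𝟙_ V ⟶ wcolim Φ dual
  ev : outerDiagram dual Φ ⟶ unitProf V A
  triangle_left (a : A) :
    coev ▷ Φ.obj (op a) ≫ contractLeft ev a = (λ_ (Φ.obj (op a))).hom
  triangle_right (a : A) :
    dual.obj a ◁ coev ≫ contractRight ev a = (ρ_ (dual.obj a)).hom

/-- A weight is absolute if it is right dualizable as a profunctor `1 ⇸ A`. -/
def IsAbsolute (Φ : Aᵒᵖ ⥤ V) : Prop := Nonempty (RightDual Φ)

/-- The coefficient vector of `Φ`: the trace of `𝟙 Φ`, that is, the composite
`𝟙 ⟶ ⟪Φ ⊙ Y⟫ ≅ ⟪Y ⊙ Φ⟫ ⟶ ⟪𝕀_A⟫` of the coevaluation, the symmetry and the evaluation. -/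
def coeffVector {Φ : Aᵒᵖ ⥤ V} (D : RightDual Φ) : 𝟙_ V ⟶ shadow V A :=
  D.coev ≫ coend.map (tensorDiagramSwap Φ D.dual) ≫ coend.map D.ev

end Closed

section Conjugacy

variable (A : Type w) [SmallCategory A]

/-- The endomorphisms of `A`, each with its object. -/
abbrev Endo : Type w := Σ a : A, (a ⟶ a)

/-- The relation `β ∘ α ∼ α ∘ β` for `α : a ⟶ b` and `β : b ⟶ a`. -/
inductive Endo.Rel : Endo A → Endo A → Prop
  | swap {a b : A} (α : a ⟶ b) (β : b ⟶ a) : Endo.Rel ⟨a, α ≫ β⟩ ⟨b, β ≫ α⟩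

/-- The conjugacy classes of endomorphisms in `A`: the quotient by the equivalence relation
generated by `Endo.Rel`. -/
def ConjClass : Type w := Quot (Endo.Rel A)

variable {A} in
/-- The conjugacy class of an endomorphism. -/
def ConjClass.mk {a : A} (α : a ⟶ a) : ConjClass A := Quot.mk _ ⟨a, α⟩

variable {A} in
lemma ConjClass.mk_swap {a b : A} (α : a ⟶ b) (β : b ⟶ a) :
    ConjClass.mk (α ≫ β) = ConjClass.mk (β ≫ α) :=
  Quot.sound (Endo.Rel.swap α β)

instance [FinCategory A] : Finite (ConjClass A) :=
  inferInstanceAs (Finite (Quot (Endo.Rel A)))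

instance [FinCategory A] : Fintype (ConjClass A) := Fintype.ofFinite _

end Conjugacy

section Semiadditive

variable {V : Type u} [Category.{v} V] [MonoidalCategory V] [HasColimitsOfSize.{w, w} V]
  {A : Type w} [SmallCategory A]

/-- The coprojection `𝟙 ⟶ ⟪𝕀_A⟫` at an endomorphism `α`. -/
def shadowι {a : A} (α : a ⟶ a) : 𝟙_ V ⟶ shadow V A :=
  unitProfι α ≫ coend.ι (unitProf V A) a

open Classical in
/-- The projection of `⟪𝕀_A⟫`, a sum of copies of `𝟙` indexed by the conjugacy classes of `A`, onto
the copy at the class `c`. -/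
def shadowProj [HasZeroMorphisms V] (c : ConjClass A) : shadow V A ⟶ 𝟙_ V :=
  coend.desc (fun _ => unitProfDesc fun α => if ConjClass.mk α = c then 𝟙 (𝟙_ V) else 0)
    (fun a b f => unitProf_hom_ext fun β => by
      erw [reassoc_of% unitProfι_map_app (V := V) β f, reassoc_of% unitProfι_map (V := V) β f]
      rw [unitProfι_desc, unitProfι_desc, ConjClass.mk_swap])

open Classical in
lemma shadowι_proj [HasZeroMorphisms V] {a : A} (α : a ⟶ a) (c : ConjClass A) :
    shadowι α ≫ shadowProj c = if ConjClass.mk α = c then 𝟙 (𝟙_ V) else 0 := by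
  rw [shadowι, shadowProj, Category.assoc]
  erw [coend.ι_desc]
  exact unitProfι_desc _ α

/-- The coefficient `φ_c` of an absolute weight: the entry of its coefficient vector at `c`. -/
def coeff [SymmetricCategory V] [MonoidalClosed V] [HasZeroMorphisms V] {Φ : Aᵒᵖ ⥤ V}
    (D : RightDual Φ) (c : ConjClass A) : 𝟙_ V ⟶ 𝟙_ V :=
  coeffVector D ≫ shadowProj c

end Semiadditive

end

end WeightedColim

open WeightedColim

/- The addition on the hom-sets of a semi-additive category: `f + g` is the composite
`X ⟶ X ⊞ X ⟶ Y` of the diagonal and `(f, g)`. -/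
attribute [local instance] hasBinaryBiproducts_of_finite_biproducts
attribute [local instance]
  SemiadditiveOfBinaryBiproducts.addCommMonoidHomOfHasBinaryBiproducts

/-! Read `Φ` as a profunctor `1 ⇸ A` and `X` as a profunctor `A ⇸ 1`. The first has a right dual `Y`
by assumption, the second has the presheaf of pointwise duals, and `∫^a Φ a ⊗ X a` is their
composite. Dual pairs compose, so its dual is `∫^a (X a)* ⊗ Y a`. The coevaluation is that of `Φ`
with the coevaluations of the `X a` inserted in the middle (`wcolimInsert`). The evaluation
contracts `Y b ⊗ Φ a` to `A(a, b) · 𝟙`, lets this act on `X a`, and evaluates at `X b` (`wcolimEv`).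

In the trace, the symmetry pulls the loop formed by the coevaluation and evaluation of `X a` away
from the strands of `Φ` and `Y` (`insertPair_braiding_contractPair`). What remains is `coeffVector`
followed by the partial trace of the action of `A(a, a) · 𝟙` on `X a`, whose component at `α` is the
trace of `X α ≫ f a` (`trace_wcolimMap`). By cyclicity (`trace_comm`) this component depends only on
the conjugacy class. Semi-additivity enters only at the end: it writes the resulting morphism out of
`shadow` as a sum over the projections to the classes (`shadowι_sum_proj`). -/

namespace WeightedColim

noncomputable section

/-! ### String-diagram identities for dual pairs. -/

section Pairings

variable {V : Type u} [Category.{v} V] [MonoidalCategory V]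

/-- Inserting a coevaluation-like morphism `𝟙 ⟶ X ⊗ Z` in the middle of `P ⊗ Q`. -/
def insertPair (P Q : V) {X Z : V} (m : 𝟙_ V ⟶ X ⊗ Z) : P ⊗ Q ⟶ (P ⊗ X) ⊗ (Z ⊗ Q) :=
  P ◁ (λ_ Q).inv ≫ P ◁ m ▷ Q ≫ P ◁ (α_ X Z Q).hom ≫ (α_ P X (Z ⊗ Q)).inv

lemma insertPair_naturality_left {P P' : V} (p : P ⟶ P') (Q : V) {X Z : V} (m : 𝟙_ V ⟶ X ⊗ Z) :
    p ▷ Q ≫ insertPair P' Q m = insertPair P Q m ≫ p ▷ X ▷ (Z ⊗ Q) := by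
  rw [insertPair, ← whisker_exchange_assoc, ← whisker_exchange_assoc, ← whisker_exchange_assoc,
    insertPair]
  monoidal

lemma insertPair_naturality_right (P : V) {Q Q' : V} (q : Q ⟶ Q') {X Z : V} (m : 𝟙_ V ⟶ X ⊗ Z) :
    P ◁ q ≫ insertPair P Q' m = insertPair P Q m ≫ (P ⊗ X) ◁ Z ◁ q := by
  calc
    _ = P ◁ (λ_ Q).inv ≫ P ◁ (𝟙_ V ◁ q ≫ m ▷ Q') ≫ P ◁ (α_ X Z Q').hom ≫
        (α_ P X (Z ⊗ Q')).inv := by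
      rw [insertPair]; monoidal
    _ = _ := by
      rw [whisker_exchange, insertPair]; monoidal

lemma insertPair_comp_left (P Q : V) {X X' Z : V} (m : 𝟙_ V ⟶ X ⊗ Z) (f : X ⟶ X') :
    insertPair P Q (m ≫ f ▷ Z) = insertPair P Q m ≫ (P ◁ f) ▷ (Z ⊗ Q) := by
  rw [insertPair, insertPair]; monoidal

lemma insertPair_comp_right (P Q : V) {X Z Z' : V} (m : 𝟙_ V ⟶ X ⊗ Z) (f : Z ⟶ Z') :
    insertPair P Q (m ≫ X ◁ f) = insertPair P Q m ≫ (P ⊗ X) ◁ (f ▷ Q) := by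
  rw [insertPair, insertPair]; monoidal

/-- The composite of `k : (Q ⊗ P) ⊗ X ⟶ X'` with an evaluation-like morphism `Z ⊗ X' ⟶ 𝟙`. -/
def contractPair {P Q X X' Z : V} (k : (Q ⊗ P) ⊗ X ⟶ X') (e : Z ⊗ X' ⟶ 𝟙_ V) :
    (Z ⊗ Q) ⊗ (P ⊗ X) ⟶ 𝟙_ V :=
  (α_ Z Q (P ⊗ X)).hom ≫ Z ◁ (α_ Q P X).inv ≫ Z ◁ k ≫ e

lemma contractPair_whiskerLeft_snd {P Q X₀ X X' Z : V} (f : X₀ ⟶ X) (k : (Q ⊗ P) ⊗ X ⟶ X')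
    (e : Z ⊗ X' ⟶ 𝟙_ V) :
    (Z ⊗ Q) ◁ P ◁ f ≫ contractPair k e = contractPair ((Q ⊗ P) ◁ f ≫ k) e := by
  rw [contractPair, contractPair]; monoidal

lemma contractPair_whiskerLeft_fst {P P' Q X X' Z : V} (p : P ⟶ P') (k : (Q ⊗ P') ⊗ X ⟶ X')
    (e : Z ⊗ X' ⟶ 𝟙_ V) :
    (Z ⊗ Q) ◁ p ▷ X ≫ contractPair k e = contractPair ((Q ◁ p) ▷ X ≫ k) e := by
  rw [contractPair, contractPair]; monoidal

lemma contractPair_whiskerRight_snd {P Q Q' X X' Z : V} (q : Q ⟶ Q') (k : (Q' ⊗ P) ⊗ X ⟶ X')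
    (e : Z ⊗ X' ⟶ 𝟙_ V) :
    (Z ◁ q) ▷ (P ⊗ X) ≫ contractPair k e = contractPair (q ▷ P ▷ X ≫ k) e := by
  rw [contractPair, contractPair]; monoidal

lemma contractPair_whiskerRight_fst {P Q X X' Z Z' : V} (z : Z' ⟶ Z) (k : (Q ⊗ P) ⊗ X ⟶ X')
    (e : Z ⊗ X' ⟶ 𝟙_ V) :
    z ▷ Q ▷ (P ⊗ X) ≫ contractPair k e = contractPair k (z ▷ X' ≫ e) := by
  rw [contractPair, contractPair, whisker_exchange_assoc]; monoidal

lemma contractPair_comp {P Q X X' X'' Z : V} (k : (Q ⊗ P) ⊗ X ⟶ X') (f : X' ⟶ X'')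
    (e : Z ⊗ X'' ⟶ 𝟙_ V) :
    contractPair k (Z ◁ f ≫ e) = contractPair (k ≫ f) e := by
  rw [contractPair, contractPair]; monoidal

/-- Sliding `k` past the coevaluation leaves a zigzag on `X`, which the triangle identity
straightens. This is the contribution of `X` to the first triangle of the composite pair. -/
lemma insertPair_contractPair {P Q P' X' X Z : V} [ExactPairing X Z] (k : (Q ⊗ P') ⊗ X' ⟶ X) :
    insertPair P Q (η_ X Z) ▷ (P' ⊗ X') ≫ (α_ _ _ _).hom ≫ (P ⊗ X) ◁ contractPair k (ε_ X Z) ≫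
      (ρ_ _).hom = (α_ P Q (P' ⊗ X')).hom ≫ P ◁ (α_ Q P' X').inv ≫ P ◁ k := by
  calc
    _ = 𝟙 _ ⊗≫ P ◁ (η_ X Z ▷ ((Q ⊗ P') ⊗ X') ≫ (X ⊗ Z) ◁ k) ⊗≫ P ◁ X ◁ ε_ X Z ⊗≫ 𝟙 _ := by
      rw [insertPair, contractPair]; monoidal
    _ = 𝟙 _ ⊗≫ P ◁ k ⊗≫ P ◁ (η_ X Z ▷ X ⊗≫ X ◁ ε_ X Z) ⊗≫ 𝟙 _ := by
      rw [← whisker_exchange]; monoidal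
    _ = _ := by
      rw [ExactPairing.evaluation_coevaluation'']; monoidal

/-- The transpose `Z ⊗ U ⟶ Z'` of `h : U ⊗ X' ⟶ X` for dual pairs `(X, Z)` and `(X', Z')`. -/
def transposeAct {U X X' : V} (Z Z' : V) [ExactPairing X Z] [ExactPairing X' Z']
    (h : U ⊗ X' ⟶ X) : Z ⊗ U ⟶ Z' :=
  (ρ_ _).inv ≫ (Z ⊗ U) ◁ η_ X' Z' ≫ (α_ Z U (X' ⊗ Z')).hom ≫ Z ◁ (α_ U X' Z').inv ≫
    Z ◁ h ▷ Z' ≫ (α_ _ _ _).inv ≫ ε_ X Z ▷ Z' ≫ (λ_ _).hom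

lemma whiskerLeft_transposeAct {U U' X X' : V} (Z Z' : V) [ExactPairing X Z] [ExactPairing X' Z']
    (t : U' ⟶ U) (h : U ⊗ X' ⟶ X) :
    Z ◁ t ≫ transposeAct Z Z' h = transposeAct Z Z' (t ▷ X' ≫ h) := by
  calc
    _ = 𝟙 _ ⊗≫ Z ◁ (t ▷ 𝟙_ V ≫ U ◁ η_ X' Z') ⊗≫ Z ◁ h ▷ Z' ⊗≫ ε_ X Z ▷ Z' ⊗≫ 𝟙 _ := by
      rw [transposeAct]; monoidal
    _ = _ := by
      rw [← whisker_exchange, transposeAct]; monoidal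

lemma transposeAct_leftUnitor {X X' : V} [HasRightDual X] [HasRightDual X'] (g : X' ⟶ X) :
    transposeAct Xᘁ X'ᘁ ((λ_ X').hom ≫ g) = (ρ_ _).hom ≫ gᘁ := by
  rw [transposeAct, rightAdjointMate]; monoidal

/-- The two pairs may differ, so no zigzag is removed: the strand from the coevaluation of `X'`
through `h` to the evaluation of `X` is by definition the transpose of `h`, and `e` slides into it.
-/
lemma contractPair_insertPair {P' Q Q' U X X' : V} (Z Z' : V) [ExactPairing X Z]
    [ExactPairing X' Z'] (e : Q ⊗ P' ⟶ U) (h : U ⊗ X' ⟶ X) :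
    (Z ⊗ Q) ◁ insertPair P' Q' (η_ X' Z') ≫ (α_ _ _ _).inv ≫
      contractPair (e ▷ X' ≫ h) (ε_ X Z) ▷ (Z' ⊗ Q') ≫ (λ_ _).hom =
    (α_ Z Q (P' ⊗ Q')).hom ≫ Z ◁ (α_ Q P' Q').inv ≫ Z ◁ e ▷ Q' ≫ (α_ Z U Q').inv ≫
      transposeAct Z Z' h ▷ Q' := by
  have H := congrArg (· ▷ Q') (whiskerLeft_transposeAct Z Z' e h)
  rw [comp_whiskerRight] at H
  rw [associator_inv_naturality_middle_assoc, H, insertPair, contractPair, transposeAct]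
  monoidal

/-! ### Traces, partial traces and the symmetry. -/

variable [SymmetricCategory V]

/-- The morphism `f` becomes its mate `fᘁ` at the coevaluation, slides past `g`, and turns back into
`f` at the evaluation. -/
lemma trace_comm {X Y : V} [HasRightDual X] [HasRightDual Y] (f : X ⟶ Y) (g : Y ⟶ X) :
    trace (f ≫ g) = trace (g ≫ f) := by
  simp only [trace, comp_whiskerRight, Category.assoc]
  rw [← coevaluation_comp_rightAdjointMate_assoc, whisker_exchange_assoc,
    BraidedCategory.braiding_naturality_right_assoc, rightAdjointMate_comp_evaluation,
    BraidedCategory.braiding_naturality_left_assoc, BraidedCategory.braiding_naturality_left_assoc,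
    BraidedCategory.braiding_naturality_left_assoc]

/-- Cyclicity with two different duals of the same object and `g = 𝟙 X`. It allows the trace of the
weighted colimit to be computed with the explicit dual. -/
lemma trace_eq_of_dual {X : V} (d d' : HasRightDual X) (f : X ⟶ X) :
    @trace V _ _ _ X d f = @trace V _ _ _ X d' f := by
  have := @trace_comm V _ _ _ X X d d' f (𝟙 X)
  rwa [Category.comp_id, Category.id_comp] at this

/-- The partial trace `U ⟶ 𝟙` of `h : U ⊗ X ⟶ X`. -/
def partialTrace {U X : V} (Z : V) [ExactPairing X Z] (h : U ⊗ X ⟶ X) : U ⟶ 𝟙_ V :=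
  (ρ_ U).inv ≫ U ◁ η_ X Z ≫ (α_ _ _ _).inv ≫ h ▷ Z ≫ (β_ X Z).hom ≫ ε_ X Z

lemma comp_partialTrace {U U' X : V} (Z : V) [ExactPairing X Z] (t : U' ⟶ U) (h : U ⊗ X ⟶ X) :
    t ≫ partialTrace Z h = partialTrace Z (t ▷ X ≫ h) := by
  simp only [partialTrace, comp_whiskerRight, Category.assoc]
  rw [rightUnitor_inv_naturality_assoc, ← whisker_exchange_assoc,
    associator_inv_naturality_left_assoc]

lemma partialTrace_leftUnitor {X : V} [HasRightDual X] (g : X ⟶ X) :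
    partialTrace Xᘁ ((λ_ X).hom ≫ g) = trace g := by
  have h : (ρ_ (𝟙_ V)).inv ≫ 𝟙_ V ◁ η_ X Xᘁ ≫ (α_ _ _ _).inv ≫ ((λ_ X).hom ≫ g) ▷ Xᘁ =
      η_ X Xᘁ ≫ g ▷ Xᘁ := by
    monoidal
  rw [partialTrace, reassoc_of% h, trace]

/-- Both sides realize the same permutation of the four factors. On the right `X ⊗ Z` crosses `Q` as
a block, so that a morphism `𝟙_ V ⟶ X ⊗ Z` can be pulled through. -/
lemma braiding_tensor_eq (P X Z Q : V) :
    (β_ (P ⊗ X) (Z ⊗ Q)).hom ≫ (α_ Z Q (P ⊗ X)).hom ≫ Z ◁ (α_ Q P X).inv =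
      (α_ P X (Z ⊗ Q)).hom ≫ P ◁ (α_ X Z Q).inv ≫ P ◁ (β_ (X ⊗ Z) Q).hom ≫
      (α_ P Q (X ⊗ Z)).inv ≫ (β_ P Q).hom ▷ (X ⊗ Z) ≫ (α_ (Q ⊗ P) X Z).inv ≫
      (β_ ((Q ⊗ P) ⊗ X) Z).hom := by
  -- On the right-hand side of the goal `Z` and `Q` cross twice; the symmetry axiom supplies that
  -- double crossing here.
  have h : (β_ (P ⊗ X) (Z ⊗ Q)).hom =
      (P ⊗ X) ◁ (β_ Z Q).hom ≫ (β_ (P ⊗ X) (Q ⊗ Z)).hom ≫ (β_ Q Z).hom ▷ (P ⊗ X) := by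
    rw [BraidedCategory.braiding_naturality_right_assoc, ← comp_whiskerRight,
      SymmetricCategory.symmetry, id_whiskerRight, Category.comp_id]
  have h' : (β_ ((Q ⊗ P) ⊗ X) Z).hom = (α_ Q P X).hom ▷ Z ≫ (β_ (Q ⊗ (P ⊗ X)) Z).hom ≫
      Z ◁ (α_ Q P X).inv := by
    rw [BraidedCategory.braiding_naturality_left_assoc, ← MonoidalCategory.whiskerLeft_comp,
      Iso.hom_inv_id, MonoidalCategory.whiskerLeft_id, Category.comp_id]
  rw [h, h', BraidedCategory.braiding_tensor_right_hom (P ⊗ X) Q Z,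
    BraidedCategory.braiding_tensor_left_hom Q (P ⊗ X) Z,
    BraidedCategory.braiding_tensor_left_hom X Z Q,
    BraidedCategory.braiding_tensor_left_hom P X Q]
  monoidal

lemma insertPair_braiding (P Q : V) {X Z : V} (m : 𝟙_ V ⟶ X ⊗ Z) :
    insertPair P Q m ≫ (β_ (P ⊗ X) (Z ⊗ Q)).hom ≫ (α_ Z Q (P ⊗ X)).hom ≫ Z ◁ (α_ Q P X).inv =
      (β_ P Q).hom ≫ (ρ_ _).inv ≫ (Q ⊗ P) ◁ m ≫ (α_ _ X Z).inv ≫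
        (β_ ((Q ⊗ P) ⊗ X) Z).hom := by
  have h : insertPair P Q m ≫ (α_ P X (Z ⊗ Q)).hom ≫ P ◁ (α_ X Z Q).inv ≫
      P ◁ (β_ (X ⊗ Z) Q).hom ≫ (α_ P Q (X ⊗ Z)).inv = (ρ_ _).inv ≫ (P ⊗ Q) ◁ m := by
    have h' : (λ_ Q).inv ≫ m ▷ Q ≫ (β_ (X ⊗ Z) Q).hom = (ρ_ Q).inv ≫ Q ◁ m := by
      rw [BraidedCategory.braiding_naturality_left, leftUnitor_inv_braiding_assoc]
    have h'' := congrArg (P ◁ ·) h'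
    simp only [MonoidalCategory.whiskerLeft_comp] at h''
    simp only [insertPair, Category.assoc, Iso.inv_hom_id_assoc,
      MonoidalCategory.whiskerLeft_hom_inv_assoc, reassoc_of% h'']
    monoidal
  rw [braiding_tensor_eq, reassoc_of% h, whisker_exchange_assoc,
    rightUnitor_inv_naturality_assoc]

/-- Once the inserted coevaluation is moved past `Q`, the strand of `X` closes up into a loop
through `k` alone. This separates the trace over `X` from `P` and `Q`. -/
lemma insertPair_braiding_contractPair (P Q : V) {X : V} (Z : V) [ExactPairing X Z]
    (k : (Q ⊗ P) ⊗ X ⟶ X) :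
    insertPair P Q (η_ X Z) ≫ (β_ (P ⊗ X) (Z ⊗ Q)).hom ≫ contractPair k (ε_ X Z) =
      (β_ P Q).hom ≫ partialTrace Z k := by
  have h := insertPair_braiding P Q (η_ X Z) =≫ (Z ◁ k ≫ ε_ X Z)
  simp only [Category.assoc] at h
  rw [contractPair, h, partialTrace, BraidedCategory.braiding_naturality_left_assoc]

end Pairings

/-! ### Weighted colimits as coends. -/

section Coends

variable {V : Type u} [Category.{v} V] [MonoidalCategory V] [HasColimitsOfSize.{w, w} V]
  {A : Type w} [SmallCategory A]

lemma wcolim_hom_ext {Φ : Aᵒᵖ ⥤ V} {X : A ⥤ V} {W : V} {g h : wcolim Φ X ⟶ W}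
    (H : ∀ a, wcolimι Φ X a ≫ g = wcolimι Φ X a ≫ h) : g = h :=
  coend.hom_ext H

lemma wcolimι_condition (Φ : Aᵒᵖ ⥤ V) (X : A ⥤ V) {a b : A} (f : a ⟶ b) :
    Φ.map f.op ▷ X.obj a ≫ wcolimι Φ X a = Φ.obj (op b) ◁ X.map f ≫ wcolimι Φ X b :=
  coend.condition (tensorDiagram Φ X) f

lemma wcolimι_map (Φ : Aᵒᵖ ⥤ V) {X X' : A ⥤ V} (f : X ⟶ X') (a : A) :
    wcolimι Φ X a ≫ wcolimMap Φ f = Φ.obj (op a) ◁ f.app a ≫ wcolimι Φ X' a :=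
  coend.ι_map (tensorDiagramMap Φ f) a

lemma wcolimMap_id (Φ : Aᵒᵖ ⥤ V) (X : A ⥤ V) : wcolimMap Φ (𝟙 X) = 𝟙 (wcolim Φ X) := by
  refine wcolim_hom_ext fun a => ?_
  rw [wcolimι_map, NatTrans.id_app, MonoidalCategory.whiskerLeft_id, Category.id_comp,
    Category.comp_id]

/-- The presheaf of right duals of a pointwise dualizable functor. -/
def dualPresheaf (X : A ⥤ V) [∀ a, HasRightDual (X.obj a)] : Aᵒᵖ ⥤ V where
  obj a := (X.obj a.unop)ᘁ
  map f := (X.map f.unop)ᘁ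
  map_id a := by simp
  map_comp f g := by simp [comp_rightAdjointMate]

end Coends

/-! ### Tensoring with coends, and the actions of the arrows of `A`. -/

section Closed

variable {V : Type u} [Category.{v} V] [MonoidalCategory V] [SymmetricCategory V]
  [MonoidalClosed V] [HasColimitsOfSize.{w, w} V] {A : Type w} [SmallCategory A]

/-- Closedness makes `Z ⊗ -` a left adjoint, so coprojections stay jointly epic after whiskering. -/
lemma whiskerLeft_wcolim_hom_ext {Φ : Aᵒᵖ ⥤ V} {X : A ⥤ V} {Z W : V}
    {g h : Z ⊗ wcolim Φ X ⟶ W} (H : ∀ a, Z ◁ wcolimι Φ X a ≫ g = Z ◁ wcolimι Φ X a ≫ h) :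
    g = h := by
  apply MonoidalClosed.curry_injective
  refine wcolim_hom_ext fun a => ?_
  rw [← MonoidalClosed.curry_natural_left, ← MonoidalClosed.curry_natural_left, H]

lemma whiskerRight_wcolim_hom_ext {Φ : Aᵒᵖ ⥤ V} {X : A ⥤ V} {Z W : V}
    {g h : wcolim Φ X ⊗ Z ⟶ W} (H : ∀ a, wcolimι Φ X a ▷ Z ≫ g = wcolimι Φ X a ▷ Z ≫ h) :
    g = h := by
  rw [← cancel_epi (β_ Z (wcolim Φ X)).hom]
  refine whiskerLeft_wcolim_hom_ext fun a => ?_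
  rw [BraidedCategory.braiding_naturality_right_assoc,
    BraidedCategory.braiding_naturality_right_assoc, H]

/-- The morphism out of `Z ⊗ ∫^a Φ a ⊗ X a` with given components. -/
def whiskerLeftWcolimDesc (Φ : Aᵒᵖ ⥤ V) (X : A ⥤ V) (Z : V) {W : V}
    (g : ∀ a : A, Z ⊗ (Φ.obj (op a) ⊗ X.obj a) ⟶ W)
    (hg : ∀ ⦃a b : A⦄ (f : a ⟶ b),
      Z ◁ Φ.map f.op ▷ X.obj a ≫ g a = Z ◁ Φ.obj (op b) ◁ X.map f ≫ g b) :
    Z ⊗ wcolim Φ X ⟶ W :=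
  MonoidalClosed.uncurry (wcolimDesc Φ X (fun a => MonoidalClosed.curry (g a)) fun a b f => by
    rw [← MonoidalClosed.curry_natural_left, ← MonoidalClosed.curry_natural_left, hg])

lemma whiskerLeft_wcolimι_desc (Φ : Aᵒᵖ ⥤ V) (X : A ⥤ V) (Z : V) {W : V}
    (g : ∀ a : A, Z ⊗ (Φ.obj (op a) ⊗ X.obj a) ⟶ W)
    (hg : ∀ ⦃a b : A⦄ (f : a ⟶ b),
      Z ◁ Φ.map f.op ▷ X.obj a ≫ g a = Z ◁ Φ.obj (op b) ◁ X.map f ≫ g b) (a : A) :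
    Z ◁ wcolimι Φ X a ≫ whiskerLeftWcolimDesc Φ X Z g hg = g a := by
  rw [whiskerLeftWcolimDesc, ← MonoidalClosed.uncurry_natural_left, wcolimι_desc,
    MonoidalClosed.uncurry_curry]

/-- The morphism out of `(∫^a Φ a ⊗ X a) ⊗ Z` with given components. -/
def whiskerRightWcolimDesc (Φ : Aᵒᵖ ⥤ V) (X : A ⥤ V) (Z : V) {W : V}
    (g : ∀ a : A, (Φ.obj (op a) ⊗ X.obj a) ⊗ Z ⟶ W)
    (hg : ∀ ⦃a b : A⦄ (f : a ⟶ b),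
      Φ.map f.op ▷ X.obj a ▷ Z ≫ g a = (Φ.obj (op b) ◁ X.map f) ▷ Z ≫ g b) :
    wcolim Φ X ⊗ Z ⟶ W :=
  (β_ _ _).hom ≫ whiskerLeftWcolimDesc Φ X Z (fun a => (β_ _ _).hom ≫ g a) fun a b f => by
    rw [BraidedCategory.braiding_naturality_right_assoc,
      BraidedCategory.braiding_naturality_right_assoc, hg]

lemma whiskerRight_wcolimι_desc (Φ : Aᵒᵖ ⥤ V) (X : A ⥤ V) (Z : V) {W : V}
    (g : ∀ a : A, (Φ.obj (op a) ⊗ X.obj a) ⊗ Z ⟶ W)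
    (hg : ∀ ⦃a b : A⦄ (f : a ⟶ b),
      Φ.map f.op ▷ X.obj a ▷ Z ≫ g a = (Φ.obj (op b) ◁ X.map f) ▷ Z ≫ g b) (a : A) :
    wcolimι Φ X a ▷ Z ≫ whiskerRightWcolimDesc Φ X Z g hg = g a := by
  rw [whiskerRightWcolimDesc, BraidedCategory.braiding_naturality_left_assoc,
    whiskerLeft_wcolimι_desc, SymmetricCategory.symmetry_assoc]

lemma functorAct_naturality (X : A ⥤ V) (a : A) {b b' : A} (f : b ⟶ b') :
    functorAct X a b ≫ X.map f = ((unitProf V A).obj (op a)).map f ▷ X.obj a ≫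
      functorAct X a b' := by
  refine unitProfTensor_hom_ext fun α => ?_
  rw [reassoc_of% unitProfι_functorAct X α, ← comp_whiskerRight_assoc, unitProfι_map,
    unitProfι_functorAct, X.map_comp]

/-- Both actions of arrows agree in the weighted colimit. -/
lemma presheafAct_wcolimι (Φ : Aᵒᵖ ⥤ V) (X : A ⥤ V) (a b : A) :
    presheafAct Φ a b ▷ X.obj a ≫ wcolimι Φ X a =
      (α_ _ _ _).hom ≫ Φ.obj (op b) ◁ functorAct X a b ≫ wcolimι Φ X b := by
  rw [← cancel_epi (α_ _ _ _).inv, Iso.inv_hom_id_assoc]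
  apply MonoidalClosed.curry_injective
  refine unitProfTensor_hom_ext fun α => ?_
  rw [← MonoidalClosed.curry_natural_left, ← MonoidalClosed.curry_natural_left]
  congr 1
  -- On the copy of `𝟙` at `α` the claim is the coend relation for `α`.
  rw [associator_inv_naturality_middle_assoc, ← comp_whiskerRight_assoc, unitProfι_presheafAct,
    ← MonoidalCategory.whiskerLeft_comp_assoc, unitProfι_functorAct, comp_whiskerRight,
    Category.assoc, wcolimι_condition, MonoidalCategory.whiskerLeft_comp, Category.assoc,
    triangle_assoc_comp_right_assoc]

/-- The composite `(Y b ⊗ Φ a) ⊗ X a ⟶ (A(a, b) · 𝟙) ⊗ X a ⟶ X b`. -/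
def evAct {Φ : Aᵒᵖ ⥤ V} {Y : A ⥤ V} (ε : outerDiagram Y Φ ⟶ unitProf V A) (X : A ⥤ V) (a b : A) :
    (Y.obj b ⊗ Φ.obj (op a)) ⊗ X.obj a ⟶ X.obj b :=
  evApp ε a b ▷ X.obj a ≫ functorAct X a b

lemma evAct_naturality {Φ : Aᵒᵖ ⥤ V} {Y : A ⥤ V} (ε : outerDiagram Y Φ ⟶ unitProf V A)
    (X : A ⥤ V) (a : A) {b b' : A} (f : b ⟶ b') :
    Y.map f ▷ Φ.obj (op a) ▷ X.obj a ≫ evAct ε X a b' = evAct ε X a b ≫ X.map f := by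
  rw [evAct, evAct, Category.assoc, functorAct_naturality, ← comp_whiskerRight_assoc,
    evApp_naturality, comp_whiskerRight_assoc]

lemma evAct_dinatural {Φ : Aᵒᵖ ⥤ V} {Y : A ⥤ V} (ε : outerDiagram Y Φ ⟶ unitProf V A)
    (X : A ⥤ V) (b : A) {a a' : A} (f : a ⟶ a') :
    (Y.obj b ◁ Φ.map f.op) ▷ X.obj a ≫ evAct ε X a b = _ ◁ X.map f ≫ evAct ε X a' b := by
  rw [evAct, evAct, ← comp_whiskerRight_assoc, evApp_naturality_op, comp_whiskerRight_assoc,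
    functorAct_dinatural, whisker_exchange_assoc]

/-! ### The dual pair of the weighted colimit. -/

variable {Φ : Aᵒᵖ ⥤ V} (X : A ⥤ V) [∀ a, HasRightDual (X.obj a)]

/-- The coprojection `(X a)* ⊗ Y a ⟶ ∫^a (X a)* ⊗ Y a`. -/
def wcolimDualι (Y : A ⥤ V) (a : A) : (X.obj a)ᘁ ⊗ Y.obj a ⟶ wcolim (dualPresheaf X) Y :=
  wcolimι (dualPresheaf X) Y a

lemma wcolimDualι_condition (Y : A ⥤ V) {a b : A} (f : a ⟶ b) :
    (X.map f)ᘁ ▷ Y.obj a ≫ wcolimDualι X Y a = (X.obj b)ᘁ ◁ Y.map f ≫ wcolimDualι X Y b :=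
  wcolimι_condition (dualPresheaf X) Y f

lemma wcolimDual_hom_ext {Y : A ⥤ V} {W : V} {g h : wcolim (dualPresheaf X) Y ⟶ W}
    (H : ∀ a, wcolimDualι X Y a ≫ g = wcolimDualι X Y a ≫ h) : g = h :=
  wcolim_hom_ext H

/-- The morphism out of `(∫^a (X a)* ⊗ Y a) ⊗ Z` with given components. -/
def wcolimDualDesc (Y : A ⥤ V) (Z : V) {W : V} (g : ∀ a : A, ((X.obj a)ᘁ ⊗ Y.obj a) ⊗ Z ⟶ W)
    (hg : ∀ ⦃a b : A⦄ (f : a ⟶ b),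
      (X.map f)ᘁ ▷ Y.obj a ▷ Z ≫ g a = ((X.obj b)ᘁ ◁ Y.map f) ▷ Z ≫ g b) :
    wcolim (dualPresheaf X) Y ⊗ Z ⟶ W :=
  whiskerRightWcolimDesc (dualPresheaf X) Y Z g hg

lemma wcolimDualι_desc (Y : A ⥤ V) (Z : V) {W : V}
    (g : ∀ a : A, ((X.obj a)ᘁ ⊗ Y.obj a) ⊗ Z ⟶ W)
    (hg : ∀ ⦃a b : A⦄ (f : a ⟶ b),
      (X.map f)ᘁ ▷ Y.obj a ▷ Z ≫ g a = ((X.obj b)ᘁ ◁ Y.map f) ▷ Z ≫ g b) (a : A) :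
    wcolimDualι X Y a ▷ Z ≫ wcolimDualDesc X Y Z g hg = g a :=
  whiskerRight_wcolimι_desc (dualPresheaf X) Y Z g hg a

/-- The action `(X b)* ⊗ (A(a, b) · 𝟙) ⟶ (X a)*` is the transpose of the action on `X`. -/
lemma transposeAct_functorAct_wcolimDualι (Y : A ⥤ V) (a b : A) :
    transposeAct (X.obj b)ᘁ (X.obj a)ᘁ (functorAct X a b) ▷ Y.obj a ≫ wcolimDualι X Y a =
      (α_ _ _ _).hom ≫ ((X.obj b)ᘁ : V) ◁ functorAct Y a b ≫ wcolimDualι X Y b := by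
  -- Both actions are given by the mate of `X α` on the copy at `α`; the claim is then
  -- `presheafAct_wcolimι` for the weight `dualPresheaf X`.
  have h : transposeAct (X.obj b)ᘁ (X.obj a)ᘁ (functorAct X a b) =
      presheafAct (dualPresheaf X) a b := by
    refine tensorUnitProf_hom_ext fun α => ?_
    rw [whiskerLeft_transposeAct, unitProfι_functorAct, transposeAct_leftUnitor]
    exact (unitProfι_presheafAct (dualPresheaf X) α).symm
  rw [h]
  exact presheafAct_wcolimι (dualPresheaf X) Y a b

/-- Insertion of the coevaluations of the objects `X a` into `∫^a Φ a ⊗ Y a`. -/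
def wcolimInsert (Φ : Aᵒᵖ ⥤ V) (X Y : A ⥤ V) [∀ a, HasRightDual (X.obj a)] :
    wcolim Φ Y ⟶ wcolim Φ X ⊗ wcolim (dualPresheaf X) Y :=
  wcolimDesc Φ Y (fun a => insertPair _ _ (η_ (X.obj a) (X.obj a)ᘁ) ≫
      wcolimι Φ X a ▷ ((X.obj a)ᘁ ⊗ Y.obj a) ≫ _ ◁ wcolimDualι X Y a) fun a b f => by
    -- The arrow `f` travels from `Φ` to `X` by the first coend relation, to `(X.map f)ᘁ` through
    -- the coevaluation, and to `Y` by the second coend relation.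
    rw [reassoc_of% insertPair_naturality_left, reassoc_of% insertPair_naturality_right,
      ← comp_whiskerRight_assoc, wcolimι_condition, comp_whiskerRight_assoc,
      ← reassoc_of% insertPair_comp_left, ← coevaluation_comp_rightAdjointMate,
      reassoc_of% insertPair_comp_right, whisker_exchange_assoc,
      ← MonoidalCategory.whiskerLeft_comp, wcolimDualι_condition,
      MonoidalCategory.whiskerLeft_comp, whisker_exchange_assoc]

lemma wcolimι_insert (Φ : Aᵒᵖ ⥤ V) (X Y : A ⥤ V) [∀ a, HasRightDual (X.obj a)] (a : A) :
    wcolimι Φ Y a ≫ wcolimInsert Φ X Y = insertPair _ _ (η_ (X.obj a) (X.obj a)ᘁ) ≫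
      wcolimι Φ X a ▷ ((X.obj a)ᘁ ⊗ Y.obj a) ≫ _ ◁ wcolimDualι X Y a :=
  wcolimι_desc _ _ _ _ a

/-- The evaluation `(∫^b (X b)* ⊗ Y b) ⊗ (∫^a Φ a ⊗ X a) ⟶ 𝟙`. -/
def wcolimEv {Y : A ⥤ V} (ε : outerDiagram Y Φ ⟶ unitProf V A) :
    wcolim (dualPresheaf X) Y ⊗ wcolim Φ X ⟶ 𝟙_ V :=
  wcolimDualDesc X Y _
    (fun b => whiskerLeftWcolimDesc Φ X ((X.obj b)ᘁ ⊗ Y.obj b)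
      (fun a => contractPair (evAct ε X a b) (ε_ (X.obj b) (X.obj b)ᘁ))
      fun a a' f => by
        rw [contractPair_whiskerLeft_fst, evAct_dinatural, contractPair_whiskerLeft_snd])
    fun b b' f => whiskerLeft_wcolim_hom_ext fun a => by
      -- The mate of `X.map f` passes through the evaluation as `X.map f`, which naturality of
      -- `evAct` trades for `Y.map f`.
      rw [whisker_exchange_assoc, whisker_exchange_assoc, whiskerLeft_wcolimι_desc,
        whiskerLeft_wcolimι_desc, contractPair_whiskerRight_fst, contractPair_whiskerRight_snd,
        evAct_naturality, rightAdjointMate_comp_evaluation, contractPair_comp]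

lemma wcolimDualι_ev {Y : A ⥤ V} (ε : outerDiagram Y Φ ⟶ unitProf V A) (a b : A) :
    wcolimDualι X Y b ▷ (Φ.obj (op a) ⊗ X.obj a) ≫ _ ◁ wcolimι Φ X a ≫ wcolimEv X ε =
      contractPair (evAct ε X a b) (ε_ (X.obj b) (X.obj b)ᘁ) := by
  rw [← whisker_exchange_assoc, wcolimEv, wcolimDualι_desc, whiskerLeft_wcolimι_desc]

/-- The first triangle, with the coevaluation of `Φ` left out. -/
lemma wcolimInsert_ev {Y : A ⥤ V} (ε : outerDiagram Y Φ ⟶ unitProf V A) (a : A) :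
    wcolim Φ Y ◁ wcolimι Φ X a ≫ wcolimInsert Φ X Y ▷ wcolim Φ X ≫ (α_ _ _ _).hom ≫
      wcolim Φ X ◁ wcolimEv X ε ≫ (ρ_ _).hom =
    (α_ _ _ _).inv ≫ contractLeft ε a ▷ X.obj a ≫ wcolimι Φ X a := by
  refine whiskerRight_wcolim_hom_ext fun b => ?_
  calc
    _ = (wcolimι Φ Y b ≫ wcolimInsert Φ X Y) ▷ (Φ.obj (op a) ⊗ X.obj a) ≫
        _ ◁ wcolimι Φ X a ≫ (α_ _ _ _).hom ≫ wcolim Φ X ◁ wcolimEv X ε ≫ (ρ_ _).hom := by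
      rw [whisker_exchange_assoc, comp_whiskerRight_assoc]
    _ = insertPair _ _ (η_ (X.obj b) (X.obj b)ᘁ) ▷ (Φ.obj (op a) ⊗ X.obj a) ≫ (α_ _ _ _).hom ≫
        wcolimι Φ X b ▷ _ ≫ wcolim Φ X ◁ (wcolimDualι X Y b ▷ (Φ.obj (op a) ⊗ X.obj a) ≫
          _ ◁ wcolimι Φ X a ≫ wcolimEv X ε) ≫ (ρ_ _).hom := by
      rw [wcolimι_insert]; monoidal
    _ = (insertPair _ _ (η_ (X.obj b) (X.obj b)ᘁ) ▷ (Φ.obj (op a) ⊗ X.obj a) ≫ (α_ _ _ _).hom ≫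
        _ ◁ contractPair (evAct ε X a b) (ε_ (X.obj b) (X.obj b)ᘁ) ≫ (ρ_ _).hom) ≫
        wcolimι Φ X b := by
      rw [wcolimDualι_ev, ← whisker_exchange_assoc, rightUnitor_naturality]
      simp only [Category.assoc]
    _ = (α_ _ _ _).hom ≫ _ ◁ (α_ _ _ _).inv ≫ _ ◁ evApp ε a b ▷ X.obj a ≫ (α_ _ _ _).inv ≫
        (α_ _ _ _).hom ≫ _ ◁ functorAct X a b ≫ wcolimι Φ X b := by
      rw [insertPair_contractPair, evAct]; monoidal
    _ = (α_ _ _ _).inv ≫ (wcolimι Φ Y b ▷ Φ.obj (op a) ≫ contractLeft ε a) ▷ X.obj a ≫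
        wcolimι Φ X a := by
      -- The arrows now act on `Φ` instead of `X`, which is the form in which the triangle of `Φ`
      -- applies.
      rw [← presheafAct_wcolimι, wcolimι_contractLeft]; monoidal
    _ = _ := by
      rw [comp_whiskerRight_assoc, associator_inv_naturality_left_assoc]

/-- The second triangle, with the coevaluation of `Φ` left out. -/
lemma ev_wcolimInsert {Y : A ⥤ V} (ε : outerDiagram Y Φ ⟶ unitProf V A) (a : A) :
    wcolimDualι X Y a ▷ wcolim Φ Y ≫ wcolim (dualPresheaf X) Y ◁ wcolimInsert Φ X Y ≫
      (α_ _ _ _).inv ≫ wcolimEv X ε ▷ _ ≫ (λ_ _).hom =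
    (α_ _ _ _).hom ≫ ((X.obj a)ᘁ : V) ◁ contractRight ε a ≫ wcolimDualι X Y a := by
  refine whiskerLeft_wcolim_hom_ext fun b => ?_
  calc
    _ = wcolimDualι X Y a ▷ _ ≫ _ ◁ (wcolimι Φ Y b ≫ wcolimInsert Φ X Y) ≫
        (α_ _ _ _).inv ≫ wcolimEv X ε ▷ _ ≫ (λ_ _).hom := by
      rw [whisker_exchange_assoc, MonoidalCategory.whiskerLeft_comp_assoc]
    _ = ((X.obj a)ᘁ ⊗ Y.obj a) ◁ insertPair _ _ (η_ (X.obj b) (X.obj b)ᘁ) ≫ (α_ _ _ _).inv ≫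
        (wcolimDualι X Y a ▷ (Φ.obj (op b) ⊗ X.obj b) ≫ _ ◁ wcolimι Φ X b) ▷ _ ≫
        (_ ◁ wcolimDualι X Y b ≫ wcolimEv X ε ▷ _) ≫ (λ_ _).hom := by
      rw [wcolimι_insert, MonoidalCategory.whiskerLeft_comp_assoc, ← whisker_exchange_assoc]
      monoidal
    _ = (((X.obj a)ᘁ ⊗ Y.obj a) ◁ insertPair _ _ (η_ (X.obj b) (X.obj b)ᘁ) ≫ (α_ _ _ _).inv ≫
        contractPair (evAct ε X b a) (ε_ (X.obj a) (X.obj a)ᘁ) ▷ _ ≫ (λ_ _).hom) ≫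
        wcolimDualι X Y b := by
      rw [whisker_exchange, ← wcolimDualι_ev]
      simp only [Category.assoc, comp_whiskerRight]
      rw [leftUnitor_naturality]
    _ = (α_ _ _ _).hom ≫ _ ◁ (α_ _ _ _).inv ≫ _ ◁ evApp ε b a ▷ Y.obj b ≫
        _ ◁ functorAct Y b a ≫ wcolimDualι X Y a := by
      rw [evAct, contractPair_insertPair]
      simp only [Category.assoc]
      -- The action on the dual of `X` moves across the coend to `Y`, producing `contractRight`.
      rw [transposeAct_functorAct_wcolimDualι, Iso.inv_hom_id_assoc]
    _ = (α_ _ _ _).hom ≫ ((X.obj a)ᘁ : V) ◁ (Y.obj a ◁ wcolimι Φ Y b ≫ contractRight ε a) ≫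
        wcolimDualι X Y a := by
      rw [wcolimι_contractRight]; monoidal
    _ = _ := by
      rw [MonoidalCategory.whiskerLeft_comp_assoc, associator_naturality_right_assoc]

/-- The weighted colimit of a pointwise dualizable functor by an absolute weight is dualizable. -/
abbrev wcolimExactPairing (D : RightDual Φ) :
    ExactPairing (wcolim Φ X) (wcolim (dualPresheaf X) D.dual) where
  coevaluation' := D.coev ≫ wcolimInsert Φ X D.dual
  evaluation' := wcolimEv X D.ev
  coevaluation_evaluation' := by
    -- The unitors turn the triangle into an equation between endomorphisms of the coend, which can
    -- be tested on coprojections.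
    rw [← cancel_mono (λ_ _).hom, ← cancel_epi (ρ_ _).inv]
    simp only [Category.assoc, Iso.inv_hom_id, Category.comp_id]
    refine wcolimDual_hom_ext X fun a => ?_
    rw [MonoidalCategory.whiskerLeft_comp_assoc, rightUnitor_inv_naturality_assoc,
      ← whisker_exchange_assoc, ev_wcolimInsert, associator_naturality_right_assoc,
      ← MonoidalCategory.whiskerLeft_comp_assoc, D.triangle_right]
    monoidal
  evaluation_coevaluation' := by
    rw [← cancel_mono (ρ_ _).hom, ← cancel_epi (λ_ _).inv]
    simp only [Category.assoc, Iso.inv_hom_id, Category.comp_id]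
    refine wcolim_hom_ext fun a => ?_
    rw [comp_whiskerRight_assoc, leftUnitor_inv_naturality_assoc,
      whisker_exchange_assoc, wcolimInsert_ev, associator_inv_naturality_left_assoc,
      ← comp_whiskerRight_assoc, D.triangle_left]
    monoidal

/-! ### The trace through the shadow of `A`. -/

/-- The trace of `colim^Φ f` is the coefficient vector of `Φ` followed by any morphism whose
components are the traces of `X α ≫ f a`. -/
lemma trace_wcolimMap (D : RightDual Φ) [HasRightDual (wcolim Φ X)] (f : X ⟶ X)
    (T : shadow V A ⟶ 𝟙_ V)
    (hT : ∀ (a : A) (α : a ⟶ a), shadowι α ≫ T = trace (X.map α ≫ f.app a)) :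
    trace (wcolimMap Φ f) = coeffVector D ≫ T := by
  let d : HasRightDual (wcolim Φ X) :=
    @HasRightDual.mk _ _ _ _ (wcolim (dualPresheaf X) D.dual) (wcolimExactPairing X D)
  refine (trace_eq_of_dual _ d _).trans ?_
  change (D.coev ≫ wcolimInsert Φ X D.dual) ≫ wcolimMap Φ f ▷ _ ≫ (β_ _ _).hom ≫
    wcolimEv X D.ev = _
  rw [coeffVector, Category.assoc, Category.assoc, Category.assoc]
  -- Removing `D.coev` leaves two morphisms out of `∫^a Φ a ⊗ Y a`, to be compared on each summand.
  congr 1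
  refine wcolim_hom_ext fun a => ?_
  have hL : wcolimι Φ D.dual a ≫ wcolimInsert Φ X D.dual ≫ wcolimMap Φ f ▷ _ ≫ (β_ _ _).hom ≫
      wcolimEv X D.ev = insertPair _ _ (η_ (X.obj a) (X.obj a)ᘁ) ≫ (β_ _ _).hom ≫
        contractPair (_ ◁ f.app a ≫ evAct D.ev X a a) (ε_ (X.obj a) (X.obj a)ᘁ) := by
    rw [reassoc_of% wcolimι_insert Φ X D.dual a, whisker_exchange_assoc,
      ← comp_whiskerRight_assoc, wcolimι_map, comp_whiskerRight_assoc,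
      BraidedCategory.braiding_naturality_right_assoc,
      BraidedCategory.braiding_naturality_left_assoc,
      BraidedCategory.braiding_naturality_left_assoc, whisker_exchange_assoc, wcolimDualι_ev,
      contractPair_whiskerLeft_snd]
  -- `T` restricted to `A(a, a) · 𝟙` is the partial trace over `X a` of the action followed by `f`,
  -- since both have the trace of `X α ≫ f a` as component at `α`.
  have hact : ∀ α : a ⟶ a, unitProfι α ≫ coend.ι (unitProf V A) a ≫ T =
      unitProfι α ≫ partialTrace (X.obj a)ᘁ (_ ◁ f.app a ≫ functorAct X a a) := fun α => by
    have := hT a α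
    rw [shadowι, Category.assoc] at this
    rw [this, comp_partialTrace, ← whisker_exchange_assoc, unitProfι_functorAct,
      leftUnitor_naturality_assoc, partialTrace_leftUnitor, f.naturality]
  have hR : wcolimι Φ D.dual a ≫ coend.map (tensorDiagramSwap Φ D.dual) ≫ coend.map D.ev ≫ T =
      (β_ _ _).hom ≫ evApp D.ev a a ≫ coend.ι (unitProf V A) a ≫ T := by
    rw [wcolimι]
    erw [coend.ι_map_assoc, coend.ι_map_assoc]
    rfl
  rw [hL, hR, insertPair_braiding_contractPair, unitProf_hom_ext hact, evAct,
    whisker_exchange_assoc, ← comp_partialTrace]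

end Closed

/-! ### Sums over conjugacy classes. -/

section Semiadditive

variable {V : Type u} [Category.{v} V] [HasZeroMorphisms V] [HasFiniteBiproducts V]

open SemiadditiveOfBinaryBiproducts in
lemma comp_finset_sum {ι : Type*} (s : Finset ι) {P Q R : V} (g : P ⟶ Q) (f : ι → (Q ⟶ R)) :
    g ≫ ∑ i ∈ s, f i = ∑ i ∈ s, g ≫ f i := by
  classical
  induction s using Finset.induction_on with
  -- The neutral element of the biproduct addition is the zero morphism by definition.
  | empty => exact comp_zero
  | insert i s hi ih => rw [Finset.sum_insert hi, Finset.sum_insert hi, comp_add, ih]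

variable [MonoidalCategory V] [SymmetricCategory V] [MonoidalClosed V]
    [HasColimitsOfSize.{w, w} V] {A : Type w} [SmallCategory A] [FinCategory A]

lemma trace_eq_of_conjClass (X : A ⥤ V) [∀ a, HasRightDual (X.obj a)] (f : X ⟶ X)
    {x y : Endo A} (h : ConjClass.mk x.2 = ConjClass.mk y.2) :
    trace (X.map x.2 ≫ f.app x.1) = trace (X.map y.2 ≫ f.app y.1) := by
  let t : ConjClass A → (𝟙_ V ⟶ 𝟙_ V) := Quot.lift (fun z => trace (X.map z.2 ≫ f.app z.1)) <| by
    rintro _ _ ⟨α, β⟩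
    dsimp only
    -- Naturality puts `f` between `X α` and `X β`; cyclicity then carries `X α` to the other end.
    rw [X.map_comp, Category.assoc, f.naturality, trace_comm, Category.assoc, f.naturality,
      X.map_comp]
  exact congrArg t h

/-- The projections send `shadowι α` to zero except at the class of `α`, where the trace does not
depend on the representative. The sum is therefore an admissible `T` in `trace_wcolimMap`. -/
lemma shadowι_sum_proj (X : A ⥤ V) [∀ a, HasRightDual (X.obj a)] (f : X ⟶ X)
    (rep : ConjClass A → Endo A) (hrep : ∀ c, ConjClass.mk (rep c).2 = c) {a : A} (α : a ⟶ a) :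
    shadowι α ≫ ∑ c : ConjClass A, shadowProj c ≫ trace (X.map (rep c).2 ≫ f.app (rep c).1) =
      trace (X.map α ≫ f.app a) := by
  classical
  rw [comp_finset_sum, Finset.sum_eq_single (ConjClass.mk α)]
  · rw [← Category.assoc, shadowι_proj, if_pos rfl, Category.id_comp]
    exact trace_eq_of_conjClass X f (x := rep _) (y := ⟨a, α⟩) (hrep _)
  · intro c _ hc
    rw [← Category.assoc, shadowι_proj, if_neg hc.symm, zero_comp]
  · intro h
    exact absurd (Finset.mem_univ _) h

end Semiadditive

end

end WeightedColim

theorem theorem1p1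
    {V : Type u} [Category.{v} V] [MonoidalCategory V] [SymmetricCategory V] [MonoidalClosed V]
    [HasColimitsOfSize.{w, w} V] [HasZeroMorphisms V] [HasFiniteBiproducts V]
    {A : Type w} [SmallCategory A] [FinCategory A]
    (Φ : Aᵒᵖ ⥤ V) (hΦ : IsAbsolute Φ)
    (X : A ⥤ V) (hX : ∀ a : A, Nonempty (HasRightDual (X.obj a))) :
    Nonempty (HasRightDual (wcolim Φ X)) ∧
    -- The formulas hold for every choice of the dual of `Φ`, of the duals of the objects `X a` and
    -- of the weighted colimit, and of a representative of each conjugacy class.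
    ∀ (D : RightDual Φ) [∀ a : A, HasRightDual (X.obj a)] [HasRightDual (wcolim Φ X)]
      (rep : ConjClass A → Endo A) (_ : ∀ c, ConjClass.mk (rep c).2 = c),
      trace (𝟙 (wcolim Φ X)) = ∑ c : ConjClass A, coeff D c ≫ trace (X.map (rep c).2) ∧
      ∀ f : X ⟶ X, trace (wcolimMap Φ f) =
        ∑ c : ConjClass A, coeff D c ≫ trace (X.map (rep c).2 ≫ f.app (rep c).1) := by
  refine ⟨?_, fun D _ _ rep hrep => ?_⟩
  · obtain ⟨D⟩ := hΦ
    have : ∀ a, HasRightDual (X.obj a) := fun a => (hX a).some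
    exact ⟨@HasRightDual.mk _ _ _ _ (wcolim (dualPresheaf X) D.dual) (wcolimExactPairing X D)⟩
  · have key : ∀ f : X ⟶ X, trace (wcolimMap Φ f) =
        ∑ c : ConjClass A, coeff D c ≫ trace (X.map (rep c).2 ≫ f.app (rep c).1) := fun f => by
      rw [trace_wcolimMap X D f _ fun a α => shadowι_sum_proj X f rep hrep α, comp_finset_sum]
      simp only [coeff, Category.assoc]
    refine ⟨?_, key⟩
    rw [← wcolimMap_id, key]
    simp only [NatTrans.id_app, Category.comp_id]
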